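/- Let $B>0$, $N>0$, and let $K\ge 0$, $r\ge 1$ be integers. A receiver observes $$y(t)=\tilde\alpha\,s(t-\tilde\tau)+\alpha\,s(t-\tau)+n(t),$$ where $s:\mathbb R\to\mathbb C$ is a known signal, $\boldsymbol\tau=(\tilde\tau,\tau)\in\mathbb R^2$ and $\boldsymbol\alpha=(\tilde\alpha,\alpha)\in\mathbb C^2$ are the unknown delays and complex attenuations of the direct and the indirect path, and $n$ is a zero-mean circularly symmetric complex Gaussian process with autocorrelation $E[n(t_1)\overline{n(t_2)}]=2BN\,\mathrm{sinc}(2B(t_1-t_2))$, $\mathrm{sinc}(u)=\sin(\pi u)/(\pi u)$. The Nyquist-rate data are $\tilde{\mathbf y}\in\mathbb C^K$, $[\tilde{\mathbf y}]_p=y\big(\tfrac{p-1}{2B}\big)$ for $1\le p\le K$. The $r$-fold oversampled data $\mathbf y\in\mathbb C^{L}$, $L=rK$, are obtained from them by upsampling and ideal low-pass filtering: $$[\mathbf y]_l=\sum_{p=1}^{K}[\tilde{\mathbf y}]_p\,\mathrm{sinc}\Big(\frac{l-1}{r}-p+1\Big),\qquad 1\le l\le L .$$ For a known threshold vector $\boldsymbol\gamma\in\mathbb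 C^{L}$, the one-bit data are $\mathbf z=Q(\mathbf y)$, with $$[\mathbf z]_l=\tfrac1{\sqrt2}\,\mathrm{sgn}\,\mathrm{Re}([\mathbf y]_l-[\boldsymbol\gamma]_l)+\tfrac{j}{\sqrt2}\,\mathrm{sgn}\,\mathrm{Im}([\mathbf y]_l-[\boldsymbol\gamma]_l),\qquad \mathrm{sgn}\in\{1,-1\},\ \mathrm{sgn}(0)=1,$$ and $\tilde{\mathbf z}=Q(\tilde{\mathbf y})$ is the one-bit quantization of the Nyquist-rate data, the sample $[\tilde{\mathbf y}]_p=[\mathbf y]_{(p-1)r+1}$ being compared with the same threshold $[\boldsymbol\gamma]_{(p-1)r+1}$. For an observation $\mathbf x$ with likelihood $f(\mathbf x\mid\theta)$ with respect to some $\sigma$-finite dominating measure, let $\mathcal I(\mathbf x\mid\theta)=\big(E\big[\partial_{\theta_i}\log f\;\partial_{\theta_j}\log f\big]\big)_{i,j}$ denote its Fisher information matrix, here with respect to the real parameter vector $\theta=(\tilde\tau,\tau,\mathrm{Re}\,\tilde\alpha,\mathrm{Im}\,\tilde\alpha,\mathrm{Re}\,\alpha,\mathrm{Im}\,\alpha)$.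 Let $\theta$ be such that $s$ is differentiable at the points $\tfrac{p-1}{2B}-\tilde\tau$ and $\tfrac{p-1}{2B}-\tau$, $1\le p\le K$. Then the Fisher information matrices of $\mathbf y,\tilde{\mathbf y},\mathbf z,\tilde{\mathbf z}$ at $\theta$ exist, and 1. (full precision) $\mathcal I(\mathbf y\mid\boldsymbol\tau,\boldsymbol\alpha)=\mathcal I(\tilde{\mathbf y}\mid\boldsymbol\tau,\boldsymbol\alpha)$; 2. (one bit) $\mathcal I(\mathbf z\mid\boldsymbol\tau,\boldsymbol\alpha)\succeq\mathcal I(\tilde{\mathbf z}\mid\boldsymbol\tau,\boldsymbol\alpha)$, that is, the difference is symmetric positive semidefinite. -/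

import Mathlib

open MeasureTheory ProbabilityTheory Filter Topology

namespace OneBit

noncomputable section

/-! ### Fisher information matrices -/

section Fisher

/-- `f` is a family of densities (likelihood functions) `f(x | θ)`, with respect to the
dominating measure `ν`, of the statistical model `θ ↦ P θ`. -/
structure IsLikelihood {ι X : Type*} [MeasurableSpace X] (P : (ι → ℝ) → Measure X)
    (ν : Measure X) (f : (ι → ℝ) → X → ℝ) : Prop where
  sigmaFinite : SigmaFinite ν
  measurable : ∀ θ, Measurable (f θ)
  nonneg : ∀ θ x, 0 ≤ f θ x
  eq_withDensity : ∀ θ, P θ = ν.withDensity fun x => ENNReal.ofReal (f θ x)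

/-- `J` is the Fisher information matrix, at the parameter vector `θ`, of an observation whose
law under the parameter vector `θ'` is `P θ'`:  for some likelihood function `f(x | θ')` of the
model, almost every observation `x` has all partial derivatives `D i x = ∂ f(x | θ) / ∂ θ i`, the
scores `∂ log f(x | θ) / ∂ θ i = D i x / f θ x` are square integrable, and
`J i j = E [∂ log f(x | θ) / ∂ θ i * ∂ log f(x | θ) / ∂ θ j]`.

The dominating measure is arbitrary, so that continuous and discrete observations, and
observations carried by a proper subspace, are all covered.  The matrix does not depend on the
chosen likelihood function, see `IsFisherInformation.unique`. -/
def IsFisherInformation {ι X : Type*} [DecidableEq ι] [MeasurableSpace X]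
    (P : (ι → ℝ) → Measure X) (θ : ι → ℝ) (J : Matrix ι ι ℝ) : Prop :=
  ∃ (ν : Measure X) (f : (ι → ℝ) → X → ℝ) (D : ι → X → ℝ),
    IsLikelihood P ν f ∧
    (∀ i, ∀ᵐ x ∂(P θ), HasDerivAt (fun u => f (Function.update θ i u) x) (D i x) (θ i)) ∧
    (∀ i, MemLp (fun x => D i x / f θ x) 2 (P θ)) ∧
    ∀ i j, J i j = ∫ x, (D i x / f θ x) * (D j x / f θ x) ∂(P θ)

/-- The Fisher information exists: the model is regular enough at `θ`. -/
def HasFisherInformation {ι X : Type*} [DecidableEq ι] [MeasurableSpace X]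
    (P : (ι → ℝ) → Measure X) (θ : ι → ℝ) : Prop :=
  ∃ J, IsFisherInformation P θ J

open Classical in
/-- The Fisher information matrix of the model `P` at `θ` (zero if it does not exist). -/
def fisherInformation {ι X : Type*} [DecidableEq ι] [MeasurableSpace X]
    (P : (ι → ℝ) → Measure X) (θ : ι → ℝ) : Matrix ι ι ℝ :=
  if h : HasFisherInformation P θ then h.choose else 0

/-- Likelihood ratios do not depend on the choice of the likelihood function. -/
theorem IsLikelihood.ratio_eq {ι X : Type*} [MeasurableSpace X] {P : (ι → ℝ) → Measure X}
    {ν : Measure X} {f : (ι → ℝ) → X → ℝ} (h : IsLikelihood P ν f) (θ θ' : ι → ℝ) :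
    ∀ᵐ x ∂(P θ), f θ x ≠ 0 ∧ f θ' x / f θ x = ((P θ').rnDeriv (P θ) x).toReal := by
  have := h.sigmaFinite
  have hm := h.measurable θ
  have hm' := h.measurable θ'
  have hS : MeasurableSet {x | f θ x = 0} := hm (measurableSet_singleton 0)
  have h0 : (P θ) {x | f θ x = 0} = 0 := by
    rw [h.eq_withDensity θ, withDensity_apply _ hS, setLIntegral_eq_zero_iff hS (by fun_prop)]
    refine ae_of_all _ fun x hx => ?_
    rw [Set.mem_ofPred_eq] at hx
    simp [hx]
  have hpos : ∀ᵐ x ∂(P θ), f θ x ≠ 0 := by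
    rw [ae_iff]; simpa using h0
  have hsf : SigmaFinite (P θ) := by
    rw [h.eq_withDensity θ]; infer_instance
  have hsing : ((ν.restrict {x | f θ x = 0}).withDensity
      fun x => ENNReal.ofReal (f θ' x)) ⟂ₘ P θ := by
    refine ⟨{x | f θ x = 0}ᶜ, hS.compl, ?_, by simpa using h0⟩
    refine withDensity_absolutelyContinuous _ _ ?_
    rw [Measure.restrict_apply hS.compl]; simp
  have hadd : P θ' = ((ν.restrict {x | f θ x = 0}).withDensity
      fun x => ENNReal.ofReal (f θ' x)) +
      (P θ).withDensity fun x => ENNReal.ofReal (f θ' x / f θ x) := by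
    rw [h.eq_withDensity θ, h.eq_withDensity θ', ← withDensity_mul _ (by fun_prop) (by fun_prop),
      ← withDensity_indicator hS, ← withDensity_add_left
        (by exact Measurable.indicator (by fun_prop) hS)]
    congr 1
    funext x
    simp only [Pi.add_apply, Pi.mul_apply, Set.indicator_apply, Set.mem_ofPred_eq]
    by_cases hx : f θ x = 0
    · simp [hx]
    · rw [if_neg hx, zero_add, ← ENNReal.ofReal_mul (h.nonneg θ x), mul_div_cancel₀ _ hx]
  have key := Measure.eq_rnDeriv (ν := P θ) (by fun_prop) hsing hadd
  filter_upwards [hpos, key] with x hx hk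
  exact ⟨hx, by rw [← hk, ENNReal.toReal_ofReal (div_nonneg (h.nonneg _ _) (h.nonneg _ _))]⟩

/-- Two differentiable functions that agree along a sequence tending to `a` have the same
derivative at `a`. -/
theorem deriv_eq_of_eq_on_seq {g g' : ℝ → ℝ} {d d' a : ℝ} (hg : HasDerivAt g d a)
    (hg' : HasDerivAt g' d' a) (ha : g a = g' a)
    (hs : ∀ n : ℕ, g (a + 1 / ((n : ℝ) + 1)) = g' (a + 1 / ((n : ℝ) + 1))) : d = d' := by
  have hlim : Tendsto (fun n : ℕ => a + 1 / ((n : ℝ) + 1)) atTop (𝓝[≠] a) := by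
    refine tendsto_nhdsWithin_iff.2 ⟨?_, Eventually.of_forall fun n => ?_⟩
    · simpa using tendsto_one_div_add_atTop_nhds_zero_nat.const_add a
    · have : (0 : ℝ) < 1 / ((n : ℝ) + 1) := by positivity
      simp only [Set.mem_compl_iff, Set.mem_singleton_iff]
      linarith
  refine tendsto_nhds_unique ((hasDerivAt_iff_tendsto_slope.1 hg).comp hlim) ?_
  refine ((hasDerivAt_iff_tendsto_slope.1 hg').comp hlim).congr fun n => ?_
  simp only [Function.comp_apply, slope_def_field, hs n, ha]

/-- The Fisher information matrix is well defined. -/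
theorem IsFisherInformation.unique {ι X : Type*} [DecidableEq ι] [MeasurableSpace X]
    {P : (ι → ℝ) → Measure X} {θ : ι → ℝ} {J J' : Matrix ι ι ℝ}
    (h : IsFisherInformation P θ J) (h' : IsFisherInformation P θ J') : J = J' := by
  obtain ⟨ν, f, D, hf, hD, -, hJ⟩ := h
  obtain ⟨ν', f', D', hf', hD', -, hJ'⟩ := h'
  have key : ∀ i, ∀ᵐ x ∂(P θ), D i x / f θ x = D' i x / f' θ x := by
    intro i
    have hseq : ∀ᵐ x ∂(P θ), ∀ n : ℕ,
        f (Function.update θ i (θ i + 1 / ((n : ℝ) + 1))) x / f θ x =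
        f' (Function.update θ i (θ i + 1 / ((n : ℝ) + 1))) x / f' θ x := by
      rw [ae_all_iff]
      intro n
      filter_upwards [hf.ratio_eq θ (Function.update θ i (θ i + 1 / ((n : ℝ) + 1))),
        hf'.ratio_eq θ (Function.update θ i (θ i + 1 / ((n : ℝ) + 1)))] with x hx hx'
      rw [hx.2, hx'.2]
    filter_upwards [hseq, hD i, hD' i, hf.ratio_eq θ θ, hf'.ratio_eq θ θ] with x h1 h2 h3 h4 h5
    refine deriv_eq_of_eq_on_seq (h2.div_const (f θ x)) (h3.div_const (f' θ x)) ?_ h1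
    simp [div_self h4.1, div_self h5.1]
  ext i j
  rw [hJ, hJ']
  refine integral_congr_ae ?_
  filter_upwards [key i, key j] with x hi hj
  rw [hi, hj]

theorem IsFisherInformation.fisherInformation_eq {ι X : Type*} [DecidableEq ι]
    [MeasurableSpace X] {P : (ι → ℝ) → Measure X} {θ : ι → ℝ} {J : Matrix ι ι ℝ}
    (h : IsFisherInformation P θ J) : fisherInformation P θ = J := by
  have hex : HasFisherInformation P θ := ⟨J, h⟩
  rw [fisherInformation, dif_pos hex]
  exact hex.choose_spec.unique h

end Fisher

/-! ### The received signal -/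

/-- The normalized sinc function `sin (π u) / (π u)`, with value `1` at `u = 0`. -/
def nsinc (u : ℝ) : ℝ := Real.sinc (Real.pi * u)

/-- The filtered noise: a zero-mean circularly symmetric complex Gaussian process with
autocorrelation `2 B N sinc (2 B (t₁ - t₂))`, that is, white noise of power `N` after an ideal
low-pass filter of bandwidth `B`. -/
structure IsFilteredNoise {Ω : Type*} [MeasurableSpace Ω] (P : Measure Ω) (B N : ℝ)
    (n : ℝ → Ω → ℂ) : Prop where
  isGaussianProcess : IsGaussianProcess n P
  mean_zero : ∀ t, ∫ ω, n t ω ∂P = 0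
  autocorrelation : ∀ t₁ t₂, ∫ ω, n t₁ ω * (starRingEnd ℂ) (n t₂ ω) ∂P =
    ((2 * B * N * nsinc (2 * B * (t₁ - t₂)) : ℝ) : ℂ)
  circular : ∀ t₁ t₂, ∫ ω, n t₁ ω * n t₂ ω ∂P = 0

/-- The received signal `y(t) = α' s(t - τ') + α s(t - τ) + n(t)`, where `(τ', α')` are the delay
and the complex attenuation of the direct path, `(τ, α)` those of the indirect path.  The real
parameter vector is `θ = (τ', τ, Re α', Im α', Re α, Im α)`. -/
def received {Ω : Type*} (s : ℝ → ℂ) (n : ℝ → Ω → ℂ) (θ : Fin 6 → ℝ) (t : ℝ) (ω : Ω) : ℂ :=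
  (⟨θ 2, θ 3⟩ : ℂ) * s (t - θ 0) + (⟨θ 4, θ 5⟩ : ℂ) * s (t - θ 1) + n t ω

/-- The `p`-th Nyquist sampling instant `p / (2 B)` (indices start at `0`). -/
def nyquistTime (B : ℝ) {K : ℕ} (p : Fin K) : ℝ := (p : ℝ) / (2 * B)

/-- The `K` samples of the received signal at the Nyquist rate `2 B`. -/
def nyquistSamples {Ω : Type*} (s : ℝ → ℂ) (n : ℝ → Ω → ℂ) (B : ℝ) (K : ℕ) (θ : Fin 6 → ℝ)
    (ω : Ω) : Fin K → ℂ :=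
  fun p => received s n θ (nyquistTime B p) ω

/-- `r`-fold upsampling followed by the ideal low-pass filter with cutoff `π / r` and gain `r`:
the `l`-th output is `∑ p, y p * sinc (l / r - p)` (indices start at `0`). -/
def oversample (r : ℕ) {K : ℕ} (y : Fin K → ℂ) : Fin (r * K) → ℂ :=
  fun l => ∑ p : Fin K, y p * (nsinc ((l : ℝ) / r - (p : ℝ)) : ℂ)

/-- The position `r * p` of the `p`-th Nyquist sample among the oversampled data. -/
def nyquistIndex {r K : ℕ} (hr : 1 ≤ r) (p : Fin K) : Fin (r * K) :=
  ⟨r * p, Nat.mul_lt_mul_of_pos_left p.isLt hr⟩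

/-! ### One-bit quantization -/

/-- The sign, with values in `{1, -1}`. -/
def sgn (x : ℝ) : ℝ := if 0 ≤ x then 1 else -1

/-- The one-bit quantizer with threshold vector `γ`, acting on the real and imaginary parts of
each sample. -/
def quantize {L : ℕ} (γ y : Fin L → ℂ) : Fin L → ℂ :=
  fun l => ((1 / Real.sqrt 2 * sgn (y l - γ l).re : ℝ) : ℂ) +
    Complex.I * ((1 / Real.sqrt 2 * sgn (y l - γ l).im : ℝ) : ℂ)

end

end OneBit

namespace OneBit

/-! The autocorrelation sinc vanishes at nonzero integers, so at the Nyquist instants the real and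
imaginary parts of the noise are independent centered Gaussians of variance `B * N`. The Nyquist
data are therefore, up to splitting into parts, a Gaussian vector with fixed covariance and a mean
having partial derivatives in `θ`. Its likelihood ratio against the centered vector is an explicit
exponential with square integrable scores.

Full precision: sinc interpolation reproduces the Nyquist samples at the indices `r * p`, so
oversampling is injective. Fisher information is unchanged by an injective measurable map
(`map_of_measurableEmbedding`), so both matrices are the same `J`.

One bit: for the same reason the Nyquist bits are a subvector of the oversampled bits. Discarding
bits merges outcomes, and merging cannot increase Fisher information: this is Cauchy–Schwarz on each
fiber (`posSemidef_sub_of_fiberwise_sum`). The information of the bits exists because the Gaussian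
probability of any measurable set is differentiable in the mean (`differentiableAt_gaussianVector`),
in particular that of a quantization cell. -/

/-- Fisher information is invariant under injective transformations of the observation. -/
theorem IsFisherInformation.map_of_measurableEmbedding {ι X Y : Type*} [DecidableEq ι]
    [MeasurableSpace X] [MeasurableSpace Y] {P : (ι → ℝ) → Measure X} {θ : ι → ℝ}
    {J : Matrix ι ι ℝ} (h : IsFisherInformation P θ J) {T : X → Y} (hT : MeasurableEmbedding T) :
    IsFisherInformation (fun θ' => (P θ').map T) θ J := by
  obtain ⟨ν, f, D, hf, hD, hL, hJ⟩ := h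
  have := hf.sigmaFinite
  have hext : ∀ (g : X → ℝ) x, Function.extend T g 0 (T x) = g x :=
    fun g x => hT.injective.extend_apply _ _ _
  -- The range of `T` has full `ν.map T` measure, so the extension by zero is harmless and keeps the
  -- density nonnegative.
  refine ⟨ν.map T, fun θ' => Function.extend T (f θ') 0, fun i => Function.extend T (D i) 0,
    ⟨hT.sigmaFinite_map, fun θ' => hT.measurable_extend (hf.measurable θ') measurable_const,
      fun θ' y => ?_, fun θ' => ?_⟩, fun i => ?_, fun i => ?_, fun i j => ?_⟩
  · by_cases hy : ∃ x, T x = y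
    · obtain ⟨x, rfl⟩ := hy
      rw [hext]
      exact hf.nonneg θ' x
    · simp [Function.extend_apply' _ _ _ hy]
  · ext s hs
    rw [hf.eq_withDensity θ', hT.map_apply, withDensity_apply _ (hT.measurable hs),
      withDensity_apply _ hs, hT.restrict_map, hT.lintegral_map]
    simp only [hext]
  · rw [hT.ae_map_iff]
    filter_upwards [hD i] with x hx
    simpa only [hext] using hx
  · rw [hT.memLp_map_measure_iff]
    simpa only [Function.comp_def, hext] using hL i
  · rw [hJ, hT.integral_map]
    simp only [hext]

/-! ### Data processing for finite-valued observations -/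

/-- The quadratic form of a weighted sum of rank-one matrices. -/
theorem dotProduct_mulVec_sum_mul_div {ι U : Type*} [Fintype ι] [Fintype U] (q : U → ℝ)
    (e : ι → U → ℝ) (a : ι → ℝ) :
    a ⬝ᵥ (Matrix.of fun i j => ∑ u, e i u * e j u / q u).mulVec a =
      ∑ u, (∑ i, a i * e i u) ^ 2 / q u := by
  simp only [dotProduct, Matrix.mulVec, Matrix.of_apply, sq, Finset.sum_div, Finset.mul_sum,
    Finset.sum_mul]
  rw [Finset.sum_congr rfl fun i _ => Finset.sum_comm, Finset.sum_comm]
  refine Finset.sum_congr rfl fun u _ => Finset.sum_congr rfl fun i _ =>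
    Finset.sum_congr rfl fun j _ => ?_
  ring

/-- Merging outcomes of a finite-valued observation decreases the quadratic form of Fisher
information. -/
theorem posSemidef_sub_of_fiberwise_sum {ι V W : Type*} [Fintype ι] [Fintype V] [Fintype W]
    [DecidableEq W] {p : V → ℝ}
    (hp : ∀ v, 0 ≤ p v) {d : ι → V → ℝ} (hd : ∀ i v, p v = 0 → d i v = 0) (h : V → W) :
    ((Matrix.of fun i j => ∑ v, d i v * d j v / p v) -
      (Matrix.of fun i j => ∑ w, (∑ v with h v = w, d i v) * (∑ v with h v = w, d j v) /
        ∑ v with h v = w, p v) : Matrix ι ι ℝ).PosSemidef := by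
  refine .of_dotProduct_mulVec_nonneg ?_ fun a => ?_
  · ext i j
    simp [mul_comm]
  -- Cauchy–Schwarz in Engel form. Outcomes with `p v = 0` are allowed because `b` vanishes there
  -- and `0 / 0 = 0`.
  have sedrakyan : ∀ (s : Finset V) (b : V → ℝ), (∀ v, p v = 0 → b v = 0) →
      (∑ v ∈ s, b v) ^ 2 / ∑ v ∈ s, p v ≤ ∑ v ∈ s, b v ^ 2 / p v := by
    intro s b hb
    refine div_le_of_le_mul₀ (Finset.sum_nonneg fun v _ => hp v)
      (Finset.sum_nonneg fun v _ => div_nonneg (sq_nonneg _) (hp v))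
      (Finset.sum_sq_le_sum_mul_sum_of_sq_le_mul _ (fun v _ => div_nonneg (sq_nonneg _) (hp v))
        (fun v _ => hp v) fun v _ => ?_)
    rcases eq_or_ne (p v) 0 with h0 | h0
    · simp [h0, hb v h0]
    · rw [div_mul_cancel₀ _ h0]
  rw [star_trivial, Matrix.sub_mulVec, dotProduct_sub, dotProduct_mulVec_sum_mul_div,
    dotProduct_mulVec_sum_mul_div, sub_nonneg,
    ← Finset.sum_fiberwise _ h]
  refine Finset.sum_le_sum fun w _ => ?_
  refine le_of_eq_of_le ?_ (sedrakyan _ (fun v => ∑ i, a i * d i v) fun v hv => ?_)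
  · simp only [Finset.mul_sum]
    rw [Finset.sum_comm]
  · exact Finset.sum_eq_zero fun i _ => by rw [hd i v hv, mul_zero]

section Finite

variable {ι V W : Type*} [DecidableEq ι] [Fintype V] [MeasurableSpace V]
  [MeasurableSingletonClass V] [Fintype W] [MeasurableSpace W] [MeasurableSingletonClass W]

/-- The Fisher information matrix of a finite-valued observation. -/
theorem isFisherInformation_of_fintype {Q : (ι → ℝ) → Measure V} [∀ θ', IsFiniteMeasure (Q θ')]
    {θ : ι → ℝ} {d : ι → V → ℝ}
    (hd : ∀ i v, HasDerivAt (fun u => (Q (Function.update θ i u)).real {v}) (d i v) (θ i)) :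
    IsFisherInformation Q θ (Matrix.of fun i j => ∑ v, d i v * d j v / (Q θ).real {v}) := by
  refine ⟨Measure.count, fun θ' v => (Q θ').real {v}, d,
    ⟨inferInstance, fun θ' => measurable_of_finite _, fun _ _ => measureReal_nonneg, fun θ' => ?_⟩,
    fun i => ae_of_all _ fun v => hd i v, fun i => MemLp.of_discrete, fun i j => ?_⟩
  · refine Measure.ext_of_singleton fun v => ?_
    rw [withDensity_apply _ (measurableSet_singleton v), Measure.restrict_singleton]
    simp
  · rw [integral_fintype .of_finite, Matrix.of_apply]
    refine Finset.sum_congr rfl fun v _ => ?_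
    -- An outcome of probability zero contributes nothing: its weight vanishes on the left, and
    -- division by zero gives zero on the right.
    rcases eq_or_ne ((Q θ).real {v}) 0 with h | h
    · simp [h]
    · rw [smul_eq_mul]
      field_simp

/-- **Data processing**: a function of a finite-valued observation carries at most as much Fisher
information as the observation. -/
theorem fisherInformation_map_le [Fintype ι] {Q : (ι → ℝ) → Measure V}
    [∀ θ', IsFiniteMeasure (Q θ')] {θ : ι → ℝ}
    (hd : ∀ i v, DifferentiableAt ℝ (fun u => (Q (Function.update θ i u)).real {v}) (θ i))
    (h : V → W) :
    HasFisherInformation Q θ ∧ HasFisherInformation (fun θ' => (Q θ').map h) θ ∧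
      (fisherInformation Q θ - fisherInformation (fun θ' => (Q θ').map h) θ).PosSemidef := by
  classical
  have hmap : ∀ θ' w, ((Q θ').map h).real {w} = ∑ v with h v = w, (Q θ').real {v} := by
    intro θ' w
    rw [map_measureReal_apply (measurable_of_finite h) (measurableSet_singleton w),
      sum_measureReal_singleton]
    congr 1
    ext v
    simp
  have h1 := isFisherInformation_of_fintype fun i v => (hd i v).hasDerivAt
  have h2 := isFisherInformation_of_fintype (Q := fun θ' => (Q θ').map h) (θ := θ)
    (d := fun i w => ∑ v with h v = w, deriv (fun u => (Q (Function.update θ i u)).real {v}) (θ i))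
    fun i w => by
      simp only [hmap]
      exact HasDerivAt.fun_sum fun v _ => (hd i v).hasDerivAt
  refine ⟨⟨_, h1⟩, ⟨_, h2⟩, ?_⟩
  rw [h1.fisherInformation_eq, h2.fisherInformation_eq]
  simp only [hmap]
  refine posSemidef_sub_of_fiberwise_sum (fun v => measureReal_nonneg) (fun i v hv => ?_) h
  -- A probability that is zero at `θ` is at its minimum, so its partial derivatives vanish.
  refine IsLocalMin.deriv_eq_zero (Eventually.of_forall fun u => ?_)
  simp only [Function.update_eq_self, hv]
  exact measureReal_nonneg

end Finite

end OneBit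

/-! ### Gaussian vectors with variable mean: likelihood ratio, scores, smoothness -/

namespace OneBit

/-- A product of measures with densities has the product density. -/
theorem pi_withDensity_ofReal {κ : Type*} [Fintype κ] {X : Type*} [MeasurableSpace X]
    (μ : κ → Measure X) [∀ k, SigmaFinite (μ k)] {f : κ → X → ℝ} (h0 : ∀ k x, 0 ≤ f k x) (hi : ∀ k, Integrable (f k) (μ k)) :
    Measure.pi (fun k => (μ k).withDensity fun x => ENNReal.ofReal (f k x)) =
      (Measure.pi μ).withDensity fun x => ENNReal.ofReal (∏ k, f k (x k)) := by
  refine Measure.pi_eq fun s hs => ?_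
  rw [withDensity_apply _ (MeasurableSet.univ_pi hs), Measure.restrict_pi_pi,
    ← ofReal_integral_eq_lintegral_ofReal
      (Integrable.fintype_prod fun k => (hi k).restrict)
      (ae_of_all _ fun x => Finset.prod_nonneg fun k _ => h0 k _),
    integral_fintype_prod_eq_prod,
    ENNReal.ofReal_prod_of_nonneg fun k _ => integral_nonneg (h0 k)]
  refine Finset.prod_congr rfl fun k _ => ?_
  rw [withDensity_apply _ (hs k), ofReal_integral_eq_lintegral_ofReal (hi k).restrict
    (ae_of_all _ (h0 k))]

/-- Translating a real Gaussian measure multiplies it by an exponential density. -/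
theorem gaussianReal_eq_withDensity_exp (m : ℝ) {v : NNReal} (hv : v ≠ 0) :
    gaussianReal m v = (gaussianReal 0 v).withDensity
      fun x => ENNReal.ofReal (Real.exp ((m * x - m ^ 2 / 2) / v)) := by
  rw [gaussianReal_of_var_ne_zero _ hv, gaussianReal_of_var_ne_zero _ hv,
    ← withDensity_mul _ (measurable_gaussianPDF 0 v) (by fun_prop)]
  congr 1
  funext x
  have hv' : (v : ℝ) ≠ 0 := by exact_mod_cast hv
  rw [Pi.mul_apply, gaussianPDF, gaussianPDF, ← ENNReal.ofReal_mul (gaussianPDFReal_nonneg _ _ _),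
    gaussianPDFReal, gaussianPDFReal, mul_assoc _ (Real.exp _), ← Real.exp_add]
  congr 4
  field_simp
  ring

section GaussianShift

variable {κ : Type*} [Fintype κ]

/-- The law of a vector with independent Gaussian entries of means `m k` and variance `v`. -/
noncomputable def gaussianVector (v : NNReal) (m : κ → ℝ) : Measure (κ → ℝ) :=
  Measure.pi fun k => gaussianReal (m k) v

instance (v : NNReal) (m : κ → ℝ) : IsProbabilityMeasure (gaussianVector v m) := by
  unfold gaussianVector
  infer_instance

/-- The density of `gaussianVector v m` with respect to `gaussianVector v 0`. -/
noncomputable def gaussianRatio (v : NNReal) (m x : κ → ℝ) : ℝ :=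
  Real.exp (∑ k, (m k * x k - m k ^ 2 / 2) / v)

theorem measurable_gaussianRatio (v : NNReal) (m : κ → ℝ) : Measurable (gaussianRatio v m) := by
  unfold gaussianRatio
  fun_prop

theorem gaussianRatio_pos (v : NNReal) (m x : κ → ℝ) : 0 < gaussianRatio v m x :=
  Real.exp_pos _

theorem integrable_exp_linear_gaussianReal (a b : ℝ) (v : NNReal) :
    Integrable (fun x => Real.exp (a * x + b)) (gaussianReal 0 v) := by
  simp_rw [Real.exp_add]
  exact (integrable_exp_mul_gaussianReal a).mul_const _

theorem gaussianVector_eq_withDensity {v : NNReal} (hv : v ≠ 0) (m : κ → ℝ) :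
    gaussianVector v m =
      (gaussianVector v 0).withDensity fun x => ENNReal.ofReal (gaussianRatio v m x) := by
  have h := pi_withDensity_ofReal (fun _ : κ => gaussianReal 0 v)
    (f := fun k x => Real.exp ((m k * x - m k ^ 2 / 2) / v)) (fun k x => (Real.exp_pos _).le)
    fun k => by
      refine (integrable_exp_linear_gaussianReal (m k / v) (-(m k ^ 2 / 2 / v)) v).congr
        (ae_of_all _ fun x => ?_)
      simp only
      congr 1
      ring
  simp only [gaussianVector, gaussianRatio, Real.exp_sum, Pi.zero_apply]
  rw [← h]
  congr 1
  funext k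
  exact gaussianReal_eq_withDensity_exp (m k) hv

theorem hasDerivAt_gaussianRatio (v : NNReal) {m : ℝ → κ → ℝ} {m' : κ → ℝ} {u : ℝ}
    (hm : ∀ k, HasDerivAt (fun u => m u k) (m' k) u) (x : κ → ℝ) :
    HasDerivAt (fun u => gaussianRatio v (m u) x)
      (gaussianRatio v (m u) x * ∑ k, m' k * (x k - m u k) / v) u := by
  refine HasDerivAt.exp (HasDerivAt.fun_sum fun k _ => ?_)
  refine ((((hm k).mul_const (x k)).sub (((hm k).pow 2).div_const 2)).div_const (v : ℝ)).congr_deriv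
    ?_
  simp
  ring

/-- The Fisher information of a Gaussian vector with independent entries, whose mean depends on
the parameter, exists. -/
theorem hasFisherInformation_gaussianVector {ι : Type*} [DecidableEq ι] {v : NNReal} (hv : v ≠ 0)
    {m : (ι → ℝ) → κ → ℝ} {m' : ι → κ → ℝ} {θ : ι → ℝ}
    (hm : ∀ i k, HasDerivAt (fun u => m (Function.update θ i u) k) (m' i k) (θ i)) :
    HasFisherInformation (fun θ' => gaussianVector v (m θ')) θ := by
  refine ⟨_, gaussianVector v 0, fun θ' => gaussianRatio v (m θ'),
    fun i x => gaussianRatio v (m θ) x * ∑ k, m' i k * (x k - m θ k) / v,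
    ⟨inferInstance, fun θ' => measurable_gaussianRatio v _, fun θ' x => (gaussianRatio_pos v _ x).le,
      fun θ' => gaussianVector_eq_withDensity hv _⟩, fun i => ae_of_all _ fun x => ?_,
      fun i => ?_, fun i j => rfl⟩
  · simpa using hasDerivAt_gaussianRatio v (hm i) x
  · have : ∀ x, gaussianRatio v (m θ) x ≠ 0 := fun x => (gaussianRatio_pos v _ x).ne'
    -- After cancelling the density, the score is affine in the coordinates, which have finite
    -- second moments.
    simp_rw [mul_div_cancel_left₀ _ (this _)]
    refine memLp_finsetSum _ fun k _ => ?_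
    have hk : MemLp (fun x : κ → ℝ => x k) 2 (gaussianVector v (m θ)) :=
      (memLp_id_gaussianReal 2).comp_measurePreserving
        (measurePreserving_eval (fun k => gaussianReal (m θ k) v) k)
    simp_rw [mul_div_right_comm]
    exact (hk.sub (memLp_const _)).const_mul _

/-- The full Fréchet derivative is needed because one delay or attenuation parameter moves several
coordinates of the mean at once. -/
theorem hasFDerivAt_gaussianRatio (v : NNReal) (m x : κ → ℝ) :
    HasFDerivAt (fun m => gaussianRatio v m x)
      (gaussianRatio v m x • ∑ k, ((x k - m k) / v) • ContinuousLinearMap.proj (R := ℝ) k) m := by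
  refine HasFDerivAt.exp (HasFDerivAt.fun_sum fun k _ => ?_)
  have h : HasFDerivAt (fun m : κ → ℝ => m k) (ContinuousLinearMap.proj (R := ℝ) k) m :=
    hasFDerivAt_apply k m
  have h2 : HasDerivAt (fun t : ℝ => (t * x k - t ^ 2 / 2) / v) ((x k - m k) / v) (m k) := by
    refine ((((hasDerivAt_id (m k)).mul_const (x k)).sub
      (((hasDerivAt_id (m k)).pow 2).div_const 2)).div_const (v : ℝ)).congr_deriv ?_
    simp
  exact h2.comp_hasFDerivAt m h

/-- Dropping `-m k ^ 2 / 2` leaves a bound depending on the mean only through its norm, hence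
uniform on balls, as domination requires. -/
theorem gaussianRatio_le {v : NNReal} (m x : κ → ℝ) :
    gaussianRatio v m x ≤ Real.exp (∑ k, ‖m‖ / v * |x k|) := by
  refine Real.exp_le_exp.2 (Finset.sum_le_sum fun k _ => ?_)
  rw [div_mul_eq_mul_div]
  gcongr
  have h1 : m k * x k ≤ ‖m‖ * |x k| := by
    refine (le_abs_self _).trans ?_
    rw [abs_mul]
    gcongr
    exact norm_le_pi_norm m k
  nlinarith [sq_nonneg (m k)]

theorem integrable_exp_sum_abs_gaussianVector (c : ℝ) (v : NNReal) :
    Integrable (fun x : κ → ℝ => Real.exp (∑ k, c * |x k|)) (gaussianVector v 0) := by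
  simp_rw [Real.exp_sum]
  refine Integrable.fintype_prod (f := fun (_ : κ) t => Real.exp (c * |t|)) fun k => ?_
  refine ((integrable_exp_mul_gaussianReal (μ := 0) (v := v) c).add
    (integrable_exp_mul_gaussianReal (μ := 0) (v := v) (-c))).mono' (by fun_prop) ?_
  refine ae_of_all _ fun t => ?_
  rw [Real.norm_eq_abs, Real.abs_exp, Pi.add_apply]
  -- `exp (c * |t|)` is one of the two terms `exp (c * t)`, `exp (-c * t)`, and the other is
  -- positive.
  rcases abs_choice t with h | h <;> rw [h]
  · exact le_add_of_nonneg_right (Real.exp_pos _).le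
  · rw [mul_neg, neg_mul]
    exact le_add_of_nonneg_left (Real.exp_pos _).le

/-- The probability of an event under a Gaussian vector is a differentiable function of the
mean. -/
theorem differentiableAt_gaussianVector {v : NNReal} (hv : v ≠ 0) {A : Set (κ → ℝ)}
    (hA : MeasurableSet A) (m₀ : κ → ℝ) :
    DifferentiableAt ℝ (fun m => (gaussianVector v m).real A) m₀ := by
  have hreal : ∀ m, (gaussianVector v m).real A =
      ∫ x in A, gaussianRatio v m x ∂(gaussianVector v 0) := by
    intro m
    rw [Measure.real, gaussianVector_eq_withDensity hv, withDensity_apply _ hA,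
      integral_eq_lintegral_of_nonneg_ae (ae_of_all _ fun x => (gaussianRatio_pos v m x).le)
        (measurable_gaussianRatio v m).aestronglyMeasurable]
  simp_rw [hreal]
  have hv0 : (0 : ℝ) < v := by exact_mod_cast pos_iff_ne_zero.2 hv
  -- `C` bounds `‖m‖` on the unit ball around `m₀`. In the dominating function, `C / v` in the
  -- second exponent comes from the ratio; the first factor and `1 / v` come from the derivative of
  -- the exponent.
  set C := ‖m₀‖ + 1
  have hC : 0 ≤ C := by positivity
  refine (hasFDerivAt_integral_of_dominated_of_fderiv_le (𝕜 := ℝ)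
    (F' := fun m x =>
      gaussianRatio v m x • ∑ k, ((x k - m k) / v) • ContinuousLinearMap.proj (R := ℝ) k)
    (bound := fun x => Real.exp (Fintype.card κ * C / v) * Real.exp (∑ k, (C / v + 1 / v) * |x k|))
    (Metric.ball_mem_nhds m₀ one_pos)
    (Eventually.of_forall fun m => (measurable_gaussianRatio v m).aestronglyMeasurable)
    ?_ ?_ (ae_of_all _ fun x m hm => ?_) ?_
    (ae_of_all _ fun x m _ => hasFDerivAt_gaussianRatio v m x)).differentiableAt
  · refine Integrable.restrict ?_
    refine (integrable_exp_sum_abs_gaussianVector (‖m₀‖ / v) v).mono'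
      (measurable_gaussianRatio v m₀).aestronglyMeasurable (ae_of_all _ fun x => ?_)
    rw [Real.norm_eq_abs, gaussianRatio, Real.abs_exp]
    exact gaussianRatio_le m₀ x
  · refine ((measurable_gaussianRatio v m₀).aestronglyMeasurable).smul ?_
    exact Continuous.aestronglyMeasurable (by fun_prop)
  · have hmC : ‖m‖ ≤ C := by
      have := norm_sub_norm_le m m₀
      rw [Metric.mem_ball, dist_eq_norm] at hm
      linarith
    have h1 : ‖∑ k, ((x k - m k) / v) • ContinuousLinearMap.proj (R := ℝ) (φ := fun _ : κ => ℝ) k‖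
        ≤ Real.exp (Fintype.card κ * C / v) * Real.exp (∑ k, 1 / v * |x k|) := by
      rw [← Real.exp_add]
      -- The norm is at most `∑ k, (C + |x k|) / v`; `t + 1 ≤ exp t` turns this into an exponential
      -- that multiplies with the bound on the ratio.
      refine (norm_sum_le _ _).trans (le_trans ?_ (Real.add_one_le_exp _))
      have : Fintype.card κ * C / v = ∑ _k : κ, C / v := by simp [mul_div_assoc]
      rw [this, ← Finset.sum_add_distrib]
      refine (Finset.sum_le_sum fun k _ => ?_).trans (le_add_of_nonneg_right zero_le_one)
      rw [norm_smul, norm_div, Real.norm_of_nonneg hv0.le, one_div_mul_eq_div, ← add_div]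
      have hproj : ‖ContinuousLinearMap.proj (R := ℝ) (φ := fun _ : κ => ℝ) k‖ ≤ 1 :=
        ContinuousLinearMap.opNorm_le_bound _ zero_le_one fun y => by
          simpa using norm_le_pi_norm y k
      refine (mul_le_of_le_one_right (by positivity) hproj).trans ?_
      gcongr
      refine (norm_sub_le _ _).trans ?_
      rw [add_comm, Real.norm_eq_abs (x k)]
      gcongr
      exact (norm_le_pi_norm m k).trans hmC
    rw [norm_smul, gaussianRatio, Real.norm_eq_abs, Real.abs_exp]
    calc _ ≤ Real.exp (∑ k, C / v * |x k|) *
          (Real.exp (Fintype.card κ * C / v) * Real.exp (∑ k, 1 / v * |x k|)) := by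
          refine mul_le_mul ((gaussianRatio_le m x).trans ?_) h1 (norm_nonneg _) (Real.exp_pos _).le
          gcongr
      _ = _ := by
          simp only [add_mul, Finset.sum_add_distrib, Real.exp_add]
          ring
  · exact ((integrable_exp_sum_abs_gaussianVector _ v).const_mul _).restrict

end GaussianShift

end OneBit

/-! ### The Nyquist samples as a Gaussian vector -/

namespace OneBit

/-- The real part (`false`) and the imaginary part (`true`) of a complex number. -/
noncomputable def part (b : Bool) : ℂ →L[ℝ] ℝ := bif b then Complex.imCLM else Complex.reCLM

@[simp]
theorem part_false (z : ℂ) : part false z = z.re := rfl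

@[simp]
theorem part_true (z : ℂ) : part true z = z.im := rfl

/-- The complex vector with given real and imaginary parts. -/
def ofParts {κ : Type*} (x : κ × Bool → ℝ) : κ → ℂ := fun k => ⟨x (k, false), x (k, true)⟩

theorem ofParts_part {κ : Type*} (y : κ → ℂ) : ofParts (fun k => part k.2 (y k.1)) = y := rfl

theorem ofParts_injective {κ : Type*} : Function.Injective (ofParts (κ := κ)) := by
  intro x x' h
  ext ⟨k, b⟩
  have := congr_fun h k
  cases b
  · exact congrArg Complex.re this
  · exact congrArg Complex.im this

theorem measurable_ofParts {κ : Type*} : Measurable (ofParts (κ := κ)) :=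
  measurable_pi_lambda _ fun k => by
    have : (fun x : κ × Bool → ℝ => ofParts x k) =
        fun x => (x (k, false) : ℂ) + x (k, true) * Complex.I := by
      funext x
      exact Complex.mk_eq_add_mul_I _ _
    rw [this]
    fun_prop

theorem nsinc_zero : nsinc 0 = 1 := by simp [nsinc]

theorem nsinc_intCast {k : ℤ} (hk : k ≠ 0) : nsinc k = 0 := by
  rw [nsinc, Real.sinc_of_ne_zero (mul_ne_zero Real.pi_ne_zero (by exact_mod_cast hk)), mul_comm,
    Real.sin_int_mul_pi, zero_div]

theorem nsinc_natCast_sub_natCast (p q : ℕ) : nsinc ((p : ℝ) - q) = if p = q then 1 else 0 := by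
  split_ifs with h
  · rw [h, sub_self, nsinc_zero]
  · have : ((p : ℝ) - q) = ((p - q : ℤ) : ℝ) := by push_cast; rfl
    rw [this, nsinc_intCast (by omega)]

section Noise

variable {Ω : Type*} [MeasurableSpace Ω] {P : Measure Ω} {B N : ℝ} {n : ℝ → Ω → ℂ}

/-- The second moments of the real and imaginary parts of the filtered noise. -/
theorem IsFilteredNoise.integral_part_mul_part (hn : IsFilteredNoise P B N n) (t₁ t₂ : ℝ)
    (b₁ b₂ : Bool) : ∫ ω, part b₁ (n t₁ ω) * part b₂ (n t₂ ω) ∂P =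
      if b₁ = b₂ then B * N * nsinc (2 * B * (t₁ - t₂)) else 0 := by
  have hL : ∀ t, MemLp (n t) 2 P := fun t => (hn.isGaussianProcess.hasGaussianLaw_eval t).memLp_two
  have hLp : ∀ b t, MemLp (fun ω => part b (n t ω)) 2 P := fun b t => (part b).comp_memLp' (hL t)
  have hint : ∀ b b', Integrable (fun ω => part b (n t₁ ω) * part b' (n t₂ ω)) P :=
    fun b b' => (hLp b t₁).integrable_mul (hLp b' t₂)
  have hI : Integrable (fun ω => n t₁ ω * n t₂ ω) P := (hL t₁).integrable_mul (hL t₂)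
  have hI' : Integrable (fun ω => n t₁ ω * (starRingEnd ℂ) (n t₂ ω)) P :=
    (hL t₁).integrable_mul (hL t₂).star
  -- Autocorrelation and circularity give four linear equations for the four mixed moments of the
  -- parts. Each of the two like parts carries half of `2 * B * N`.
  have e1 := congrArg Complex.re (hn.autocorrelation t₁ t₂)
  have e2 := congrArg Complex.im (hn.autocorrelation t₁ t₂)
  have e3 := congrArg Complex.re (hn.circular t₁ t₂)
  have e4 := congrArg Complex.im (hn.circular t₁ t₂)
  rw [← Complex.reCLM_apply, ← Complex.reCLM.integral_comp_comm hI'] at e1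
  rw [← Complex.imCLM_apply, ← Complex.imCLM.integral_comp_comm hI'] at e2
  rw [← Complex.reCLM_apply, ← Complex.reCLM.integral_comp_comm hI] at e3
  rw [← Complex.imCLM_apply, ← Complex.imCLM.integral_comp_comm hI] at e4
  have h00 := hint false false
  have h01 := hint false true
  have h10 := hint true false
  have h11 := hint true true
  simp only [part_false, part_true] at h00 h01 h10 h11
  simp only [Complex.reCLM_apply, Complex.imCLM_apply, Complex.mul_re, Complex.mul_im,
    Complex.conj_re, Complex.conj_im, mul_neg, sub_neg_eq_add, neg_add_eq_sub, Complex.ofReal_re,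
    Complex.ofReal_im, Complex.zero_re, Complex.zero_im] at e1 e2 e3 e4
  rw [integral_add h00 h11] at e1
  rw [integral_sub h10 h01] at e2
  rw [integral_sub h00 h11] at e3
  rw [integral_add h01 h10] at e4
  cases b₁ <;> cases b₂ <;> simp <;> linarith

/-- At the Nyquist rate, the real and imaginary parts of the noise samples are independent
centered Gaussian variables with variance `B * N`. -/
theorem IsFilteredNoise.map_nyquist (hn : IsFilteredNoise P B N n) (hB : 0 < B) (K : ℕ) :
    P.map (fun ω (k : Fin K × Bool) => part k.2 (n (nyquistTime B k.1) ω)) =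
      gaussianVector (B * N).toNNReal 0 := by
  have := hn.isGaussianProcess.isProbabilityMeasure
  let I : Finset ℝ := Finset.univ.image (nyquistTime B (K := K))
  have hI : ∀ p : Fin K, nyquistTime B p ∈ I := fun p =>
    Finset.mem_image_of_mem _ (Finset.mem_univ p)
  have hG : HasGaussianLaw (fun ω (k : Fin K × Bool) => part k.2 (n (nyquistTime B k.1) ω)) P :=
    (hn.isGaussianProcess.hasGaussianLaw I).map
      (ContinuousLinearMap.pi fun k : Fin K × Bool => (part k.2).comp
        (ContinuousLinearMap.proj (R := ℝ) (φ := fun _ : I => ℂ) ⟨nyquistTime B k.1, hI k.1⟩))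
  have hk : ∀ k : Fin K × Bool, HasGaussianLaw (fun ω => part k.2 (n (nyquistTime B k.1) ω)) P :=
    fun k => hG.eval k
  have hmean : ∀ k : Fin K × Bool, ∫ ω, part k.2 (n (nyquistTime B k.1) ω) ∂P = 0 := fun k => by
    rw [(part k.2).integral_comp_comm (hn.isGaussianProcess.hasGaussianLaw_eval _).integrable,
      hn.mean_zero, map_zero]
  have hcov : ∀ k l : Fin K × Bool, cov[fun ω => part k.2 (n (nyquistTime B k.1) ω),
      fun ω => part l.2 (n (nyquistTime B l.1) ω); P] = if k = l then B * N else 0 := by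
    intro k l
    rw [covariance_eq_sub (hk k).memLp_two (hk l).memLp_two, hmean, zero_mul, sub_zero]
    -- Sampling at rate `2 * B` makes the sinc argument a difference of integers, so distinct
    -- samples are uncorrelated.
    have ht : 2 * B * (nyquistTime B k.1 - nyquistTime B l.1) = (k.1 : ℝ) - (l.1 : ℝ) := by
      simp only [nyquistTime]
      field_simp
    refine (hn.integral_part_mul_part _ _ _ _).trans ?_
    rw [ht, nsinc_natCast_sub_natCast]
    by_cases h1 : k.1 = l.1 <;> by_cases h2 : k.2 = l.2 <;>
      simp [h1, h2, Prod.ext_iff, Fin.val_inj]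
  -- For a jointly Gaussian family, zero covariance gives mutual independence.
  have hind := hG.iIndepFun_of_covariance_eq_zero fun k l hkl => by rw [hcov, if_neg hkl]
  rw [hind.map_fun_eq_pi_map fun k => (hk k).aemeasurable, gaussianVector]
  congr 1
  funext k
  rw [(hk k).map_eq_gaussianReal, hmean, ← covariance_self (hk k).aemeasurable, hcov, if_pos rfl]
  rfl

end Noise

/-- The noiseless Nyquist samples, split into real and imaginary parts. -/
noncomputable def nyquistMean (s : ℝ → ℂ) (B : ℝ) (K : ℕ) (θ : Fin 6 → ℝ) : Fin K × Bool → ℝ :=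
  fun k => part k.2 ((⟨θ 2, θ 3⟩ : ℂ) * s (nyquistTime B k.1 - θ 0) +
    (⟨θ 4, θ 5⟩ : ℂ) * s (nyquistTime B k.1 - θ 1))

theorem gaussianVector_map_add {κ : Type*} [Fintype κ] (v : NNReal) (m : κ → ℝ) :
    (gaussianVector v 0).map (fun x k => x k + m k) = gaussianVector v m := by
  rw [gaussianVector, Measure.pi_map_pi (f := fun k t => t + m k) fun k => by fun_prop]
  simp [gaussianVector, gaussianReal_map_add_const]

theorem nyquistSamples_eq_ofParts {Ω : Type*} (s : ℝ → ℂ) (n : ℝ → Ω → ℂ) (B : ℝ) (K : ℕ)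
    (θ : Fin 6 → ℝ) (ω : Ω) : nyquistSamples s n B K θ ω =
      ofParts fun k => part k.2 (n (nyquistTime B k.1) ω) + nyquistMean s B K θ k := by
  rw [← ofParts_part (nyquistSamples s n B K θ ω)]
  congr 1
  funext k
  simp only [nyquistSamples, received, nyquistMean]
  rw [map_add, add_comm]

/-- The law of a statistic of the Nyquist samples. -/
theorem IsFilteredNoise.map_nyquistSamples {Ω Y : Type*} [MeasurableSpace Ω] [MeasurableSpace Y]
    {P : Measure Ω} {B N : ℝ} {n : ℝ → Ω → ℂ} (hn : IsFilteredNoise P B N n) (hB : 0 < B)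
    (s : ℝ → ℂ) {K : ℕ} (θ : Fin 6 → ℝ) {g : (Fin K → ℂ) → Y} (hg : Measurable g) :
    P.map (fun ω => g (nyquistSamples s n B K θ ω)) =
      (gaussianVector (B * N).toNNReal (nyquistMean s B K θ)).map (fun x => g (ofParts x)) := by
  have hg' : Measurable fun x : Fin K × Bool → ℝ => g (ofParts x) := hg.comp measurable_ofParts
  have hadd : Measurable fun (x : Fin K × Bool → ℝ) k => x k + nyquistMean s B K θ k := by fun_prop
  have hW : AEMeasurable (fun ω (k : Fin K × Bool) => part k.2 (n (nyquistTime B k.1) ω)) P :=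
    aemeasurable_pi_lambda _ fun k =>
      (part k.2).continuous.measurable.comp_aemeasurable (hn.isGaussianProcess.aemeasurable _)
  rw [← gaussianVector_map_add, ← hn.map_nyquist hB K, Measure.map_map hg' hadd,
    AEMeasurable.map_map_of_aemeasurable (hg'.comp hadd).aemeasurable hW]
  simp only [nyquistSamples_eq_ofParts, Function.comp_def]

/-- The noiseless Nyquist samples have partial derivatives in all six parameters. -/
theorem differentiableAt_nyquistMean {s : ℝ → ℂ} {B : ℝ} {K : ℕ} {θ : Fin 6 → ℝ}
    (hs : ∀ p : Fin K, DifferentiableAt ℝ s (nyquistTime B p - θ 0) ∧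
      DifferentiableAt ℝ s (nyquistTime B p - θ 1)) (i : Fin 6) :
    DifferentiableAt ℝ (fun u => nyquistMean s B K (Function.update θ i u)) (θ i) := by
  refine differentiableAt_pi.2 fun k => ?_
  have hu : ∀ j, DifferentiableAt ℝ (fun u => Function.update θ i u j) (θ i) := fun j =>
    differentiableAt_pi.1 (hasDerivAt_update θ i (θ i)).differentiableAt j
  have hc : ∀ j j', DifferentiableAt ℝ
      (fun u => (⟨Function.update θ i u j, Function.update θ i u j'⟩ : ℂ)) (θ i) := fun j j' => by
    simp_rw [Complex.mk_eq_add_mul_I]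
    exact (Complex.ofRealCLM.differentiableAt.comp _ (hu j)).add
      ((Complex.ofRealCLM.differentiableAt.comp _ (hu j')).mul_const _)
  have hd : ∀ j, DifferentiableAt ℝ s (nyquistTime B k.1 - θ j) →
      DifferentiableAt ℝ (fun u => s (nyquistTime B k.1 - Function.update θ i u j)) (θ i) :=
    fun j hj => DifferentiableAt.comp (θ i)
      (by simpa only [Function.update_eq_self] using hj) ((hu j).const_sub _)
  exact (part k.2).differentiableAt.comp (θ i)
    (((hc 2 3).mul (hd 0 (hs k.1).1)).add ((hc 4 5).mul (hd 1 (hs k.1).2)))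

/-! ### Oversampling and quantization -/

/-- At index `r * p` the kernel is `nsinc (p - q)`, a Kronecker delta. Both the injectivity of
oversampling and the inclusion of the Nyquist bits among the oversampled ones rest on this. -/
theorem oversample_nyquistIndex {r K : ℕ} (hr : 1 ≤ r) (y : Fin K → ℂ) (p : Fin K) :
    oversample r y (nyquistIndex hr p) = y p := by
  have hr' : (r : ℝ) ≠ 0 := by positivity
  simp only [oversample, nyquistIndex, Nat.cast_mul, mul_div_cancel_left₀ _ hr',
    nsinc_natCast_sub_natCast]
  rw [Finset.sum_eq_single p]
  · simp
  · intro q _ hq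
    rw [if_neg fun h => hq (Fin.ext h.symm)]
    simp
  · simp

theorem oversample_injective {r : ℕ} (hr : 1 ≤ r) (K : ℕ) :
    Function.Injective (oversample r (K := K)) := fun y y' h => by
  funext p
  rw [← oversample_nyquistIndex hr y, h, oversample_nyquistIndex]

theorem measurable_oversample (r K : ℕ) : Measurable (oversample r (K := K)) := by
  unfold oversample
  fun_prop

/-- The quantization cell of a vector: `true` where the threshold is reached. -/
noncomputable def signPattern {L : ℕ} (γ y : Fin L → ℂ) : Fin L → Bool × Bool :=
  fun l => (decide (0 ≤ (y l - γ l).re), decide (0 ≤ (y l - γ l).im))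

/-- The output of the one-bit quantizer on a quantization cell. -/
noncomputable def patternValue {L : ℕ} (c : Fin L → Bool × Bool) : Fin L → ℂ :=
  fun l => ((1 / Real.sqrt 2 * (if (c l).1 then 1 else -1) : ℝ) : ℂ) +
    Complex.I * ((1 / Real.sqrt 2 * (if (c l).2 then 1 else -1) : ℝ) : ℂ)

theorem patternValue_signPattern {L : ℕ} (γ y : Fin L → ℂ) :
    patternValue (signPattern γ y) = quantize γ y := by
  funext l
  simp [patternValue, signPattern, quantize, sgn]

theorem patternValue_injective (L : ℕ) : Function.Injective (patternValue (L := L)) := by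
  intro c c' h
  have hs : (1 / Real.sqrt 2) ≠ 0 := by positivity
  have hb : ∀ b b' : Bool, 1 / Real.sqrt 2 * (if b then 1 else -1) =
      1 / Real.sqrt 2 * (if b' then 1 else -1) → b = b' := by
    intro b b' h
    have := mul_left_cancel₀ hs h
    cases b <;> cases b' <;> norm_num at this <;> rfl
  funext l
  have hl := congr_fun h l
  have h1 := congrArg Complex.re hl
  have h2 := congrArg Complex.im hl
  simp only [patternValue, Complex.add_re, Complex.add_im, Complex.ofReal_re, Complex.ofReal_im,
    Complex.I_mul_re, Complex.I_mul_im, neg_zero, add_zero, zero_add] at h1 h2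
  exact Prod.ext (hb _ _ h1) (hb _ _ h2)

theorem measurable_signPattern {L : ℕ} (γ : Fin L → ℂ) : Measurable (signPattern γ) := by
  have hdec : ∀ f : (Fin L → ℂ) → ℝ, Measurable f → Measurable fun y => decide (0 ≤ f y) :=
    fun f hf => measurable_to_bool (by
      simpa [Set.preimage] using measurableSet_le measurable_const hf)
  refine measurable_pi_lambda _ fun l => (hdec _ ?_).prodMk (hdec _ ?_)
  · exact Complex.measurable_re.comp (by fun_prop)
  · exact Complex.measurable_im.comp (by fun_prop)

theorem signPattern_comp_nyquistIndex {r K : ℕ} (hr : 1 ≤ r) (γ : Fin (r * K) → ℂ)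
    (y : Fin K → ℂ) : (fun p => signPattern γ (oversample r y) (nyquistIndex hr p)) =
      signPattern (fun p => γ (nyquistIndex hr p)) y := by
  funext p
  simp only [signPattern, oversample_nyquistIndex]

end OneBit

/-! ### Comparison of the four observations -/

theorem mainTheorem4 {Ω : Type*} [MeasurableSpace Ω] (P : Measure Ω) [IsProbabilityMeasure P]
    -- bandwidth, noise power, transmitted signal, filtered noise
    (B N : ℝ) (hB : 0 < B) (hN : 0 < N) (s : ℝ → ℂ) (n : ℝ → Ω → ℂ)
    (hn : OneBit.IsFilteredNoise P B N n)
    -- number of Nyquist samples, oversampling factor, thresholds of the one-bit quantizer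
    (K r : ℕ) (hr : 1 ≤ r) (γ : Fin (r * K) → ℂ)
    -- the value of the parameter vector at which Fisher information is taken
    (θ : Fin 6 → ℝ)
    (hs : ∀ p : Fin K, DifferentiableAt ℝ s (OneBit.nyquistTime B p - θ 0) ∧
      DifferentiableAt ℝ s (OneBit.nyquistTime B p - θ 1)) :
    -- Nyquist-rate and oversampled data, in full precision and quantized to one bit
    let yNyq : (Fin 6 → ℝ) → Ω → Fin K → ℂ := OneBit.nyquistSamples s n B K
    let y : (Fin 6 → ℝ) → Ω → Fin (r * K) → ℂ := fun θ' ω => OneBit.oversample r (yNyq θ' ω)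
    let zNyq : (Fin 6 → ℝ) → Ω → Fin K → ℂ :=
      fun θ' ω => OneBit.quantize (fun p => γ (OneBit.nyquistIndex hr p)) (yNyq θ' ω)
    let z : (Fin 6 → ℝ) → Ω → Fin (r * K) → ℂ := fun θ' ω => OneBit.quantize γ (y θ' ω)
    -- the Fisher information matrices of all four observations exist
    (OneBit.HasFisherInformation (fun θ' => P.map (y θ')) θ ∧
      OneBit.HasFisherInformation (fun θ' => P.map (yNyq θ')) θ ∧
      OneBit.HasFisherInformation (fun θ' => P.map (z θ')) θ ∧
      OneBit.HasFisherInformation (fun θ' => P.map (zNyq θ')) θ) ∧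
    OneBit.fisherInformation (fun θ' => P.map (y θ')) θ =
      OneBit.fisherInformation (fun θ' => P.map (yNyq θ')) θ ∧
    (OneBit.fisherInformation (fun θ' => P.map (z θ')) θ -
      OneBit.fisherInformation (fun θ' => P.map (zNyq θ')) θ).PosSemidef := by
  intro yNyq y zNyq z
  have hv : (B * N).toNNReal ≠ 0 := (Real.toNNReal_pos.2 (mul_pos hB hN)).ne'
  have hmean := OneBit.differentiableAt_nyquistMean hs
  have hover := OneBit.measurable_oversample r K
  -- full precision: injective images of a Gaussian vector
  obtain ⟨J, hJ⟩ := OneBit.hasFisherInformation_gaussianVector hv (θ := θ)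
    (m := OneBit.nyquistMean s B K) fun i k => (differentiableAt_pi.1 (hmean i) k).hasDerivAt
  have hyNyq : OneBit.IsFisherInformation (fun θ' => P.map (yNyq θ')) θ J := by
    have hlaw := fun θ' => hn.map_nyquistSamples hB s θ' (measurable_id (α := Fin K → ℂ))
    simp only [id] at hlaw
    simp only [yNyq, hlaw]
    -- By Lusin–Souslin, an injective measurable map between these standard Borel spaces is a
    -- measurable embedding; surjectivity plays no role, so oversampled data on a proper subspace
    -- are covered too.
    exact hJ.map_of_measurableEmbedding
      (OneBit.measurable_ofParts.measurableEmbedding OneBit.ofParts_injective)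
  have hy : OneBit.IsFisherInformation (fun θ' => P.map (y θ')) θ J := by
    have hlaw := fun θ' => hn.map_nyquistSamples hB s θ' hover
    simp only [y, yNyq, hlaw]
    exact hJ.map_of_measurableEmbedding ((hover.comp OneBit.measurable_ofParts).measurableEmbedding
      ((OneBit.oversample_injective hr K).comp OneBit.ofParts_injective))
  -- one bit: the quantization cell of the oversampled data determines that of the Nyquist data
  have hsign : Measurable fun y : Fin K → ℂ => OneBit.signPattern γ (OneBit.oversample r y) :=
    (OneBit.measurable_signPattern γ).comp hover
  -- The bits are kept in a finite type, where the data processing lemma applies; `patternValue`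
  -- then carries the result injectively to the complex-valued `z` and `zNyq`.
  let Q : (Fin 6 → ℝ) → Measure (Fin (r * K) → Bool × Bool) := fun θ' =>
    P.map fun ω => OneBit.signPattern γ (y θ' ω)
  have hQ : ∀ θ', Q θ' = _ := fun θ' => hn.map_nyquistSamples hB s θ' hsign
  have hd : ∀ i c, DifferentiableAt ℝ (fun u => (Q (Function.update θ i u)).real {c}) (θ i) := by
    intro i c
    have hmeas := hsign.comp OneBit.measurable_ofParts
    have hreal : ∀ θ', (Q θ').real {c} =
        (OneBit.gaussianVector (B * N).toNNReal (OneBit.nyquistMean s B K θ')).real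
          ((fun y => OneBit.signPattern γ (OneBit.oversample r y)) ∘ OneBit.ofParts ⁻¹' {c}) :=
      fun θ' => by
        rw [hQ]
        exact map_measureReal_apply hmeas (measurableSet_singleton c)
    simp only [hreal]
    -- Chain rule: the cell is a fixed set, and the parameter enters only through the mean.
    exact (OneBit.differentiableAt_gaussianVector hv (hmeas (measurableSet_singleton c)) _).comp
      (θ i) (hmean i)
  have hae : ∀ θ', AEMeasurable (yNyq θ') P := fun θ' =>
    aemeasurable_pi_lambda _ fun p => (hn.isGaussianProcess.aemeasurable _).const_add _
  have hvalue : ∀ L, MeasurableEmbedding (OneBit.patternValue (L := L)) := fun L =>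
    (measurable_of_finite _).measurableEmbedding (OneBit.patternValue_injective L)
  have hpattern : ∀ θ', AEMeasurable (fun ω => OneBit.signPattern γ (y θ' ω)) P :=
    fun θ' => hsign.comp_aemeasurable (hae θ')
  -- Forgetting all bits except those at the Nyquist indices; this is the merging map.
  let sub : (Fin (r * K) → Bool × Bool) → Fin K → Bool × Bool :=
    fun c p => c (OneBit.nyquistIndex hr p)
  have hz : ∀ θ', P.map (z θ') = (Q θ').map OneBit.patternValue := fun θ' => by
    rw [AEMeasurable.map_map_of_aemeasurable (hvalue _).measurable.aemeasurable
      (hpattern θ')]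
    simp only [Function.comp_def, OneBit.patternValue_signPattern, z]
  have hzNyq : ∀ θ', P.map (zNyq θ') = ((Q θ').map sub).map OneBit.patternValue := fun θ' => by
    rw [Measure.map_map (hvalue _).measurable (measurable_of_finite _),
      AEMeasurable.map_map_of_aemeasurable (measurable_of_finite _).aemeasurable
        (hpattern θ')]
    congr 1
    funext ω
    simp only [Function.comp_apply, sub, y, OneBit.signPattern_comp_nyquistIndex,
      OneBit.patternValue_signPattern, zNyq]
  have : ∀ θ', IsFiniteMeasure (Q θ') := fun θ' => inferInstance
  obtain ⟨⟨Jz, hJz⟩, ⟨Jz', hJz'⟩, hpsd⟩ := OneBit.fisherInformation_map_le hd sub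
  have h1 := hJz.map_of_measurableEmbedding (hvalue _)
  have h2 := hJz'.map_of_measurableEmbedding (hvalue _)
  simp only [← hz] at h1
  simp only [← hzNyq] at h2
  refine ⟨⟨⟨J, hy⟩, ⟨J, hyNyq⟩, ⟨Jz, h1⟩, ⟨Jz', h2⟩⟩, ?_, ?_⟩
  · rw [hy.fisherInformation_eq, hyNyq.fisherInformation_eq]
  · rw [h1.fisherInformation_eq, h2.fisherInformation_eq]
    rwa [hJz.fisherInformation_eq, hJz'.fisherInformation_eq] at hpsd
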